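/- Let $\mathcal H$ be a complex Hilbert space, let $n$ be a natural number and let $X=(X_1,\dots,X_n)$ be a tuple of pairwise commuting bounded operators on $\mathcal H$. We also write $X$ for the row operator $X:\mathcal H^n\to\mathcal H$, $X(h_i)_{i=1}^n=\sum_{i=1}^n X_ih_i$, where $\mathcal H^n$ is the Hilbert space direct sum. Let $\mathcal W(X)=\bigcap_{i=1}^n\ker X_i^*$ and $\sigma_X(Y)=\sum_{i=1}^n X_iYX_i^*$ for $Y\in\mathcal B(\mathcal H)$. Suppose that 1. $X$ is pure, that is, $\sigma_X^k(I)h\to 0$ as $k\to\infty$ for every $h\in\mathcal H$; 2. $X$ is regular at $z=0$, that is, there is $\epsilon>0$ such that for every $z\in\mathbb C^n$ with $\|z\|<\epsilon$ the subspace $(X-Z)\mathcal H^n\subseteq\mathcal H$ is closed and $\mathcal H$ is the algebraic direct sum of $(X-Z)\mathcal H^n$ and $\mathcal W(X)$, where $Z(h_i)_{i=1}^n=\sum_{i=1}^n z_ih_i$; 3. for some integer $m\ge 1$, $X$ satisfies $(X^*X)^{-1}=(\oplus\Delta_X)|_{X^*\mathcal H}$, where $\Delta_X=\sum_{j=0}^{m-1}(-1)^j\binom{m}{j+1}\sigma_X^j(I)$,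 $\oplus\Delta_X$ is the operator $(h_i)_{i=1}^n\mapsto(\Delta_Xh_i)_{i=1}^n$ on $\mathcal H^n$, and $(X^*X)^{-1}$ is the inverse of the bijection of $X^*\mathcal H\subseteq\mathcal H^n$ onto itself given by restricting $X^*X$. Call an operator $S$ on a Hilbert space $\mathcal K$ a pure contraction if $\|S\|\le 1$ and $S^{*k}h\to 0$ as $k\to\infty$ for every $h\in\mathcal K$. Let $T\in\mathcal B(\mathcal H)$ be a contraction ($\|T\|\le1$) with $TX_i=X_iT$ for all $i\in\{1,\dots,n\}$. Then the following are equivalent: (i) $T$ is a pure contraction on $\mathcal H$; (ii) the compression $P_{\mathcal W(X)}T|_{\mathcal W(X)}$ is a pure contraction on $\mathcal W(X)$. -/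

import Mathlib

open Filter Topology ContinuousLinearMap

namespace PureTuple

noncomputable section

/-- A contraction `T` (that is, `‖T‖ ≤ 1`) on a Hilbert space is pure if `T*ᵏ h → 0` for all `h`. -/
def IsPureContraction {H : Type*} [NormedAddCommGroup H] [InnerProductSpace ℂ H] [CompleteSpace H]
    (T : H →L[ℂ] H) : Prop :=
  ‖T‖ ≤ 1 ∧ ∀ h : H, Tendsto (fun k : ℕ => ((adjoint T) ^ k) h) atTop (𝓝 0)

/-- The compression `P_S T|_S` of an operator `T` to a subspace `S`. -/
def compression {H : Type*} [NormedAddCommGroup H] [InnerProductSpace ℂ H]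
    (S : Submodule ℂ H) [S.HasOrthogonalProjection] (T : H →L[ℂ] H) : S →L[ℂ] S :=
  S.orthogonalProjectionOnto ∘L T ∘L S.subtypeL

variable {H : Type*} [NormedAddCommGroup H] [InnerProductSpace ℂ H] {n : ℕ}

/-- The row operator `Hⁿ → H`, `(hᵢ) ↦ ∑ᵢ Xᵢ hᵢ`, of a tuple `(X₁, …, Xₙ)`,
on the Hilbert space direct sum `Hⁿ`. -/
def rowOp (X : Fin n → H →L[ℂ] H) : PiLp 2 (fun _ : Fin n => H) →L[ℂ] H :=
  ∑ i, X i ∘L PiLp.proj 2 (fun _ : Fin n => H) i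

/-- The scalar tuple `(z₁ I, …, zₙ I)`; its row operator is `(hᵢ) ↦ ∑ᵢ zᵢ hᵢ`. -/
def scalarTuple (H : Type*) [NormedAddCommGroup H] [InnerProductSpace ℂ H]
    (z : EuclideanSpace ℂ (Fin n)) : Fin n → H →L[ℂ] H :=
  fun i => z i • ContinuousLinearMap.id ℂ H

/-- The diagonal operator `⊕ D` on `Hⁿ`, `(hᵢ) ↦ (D hᵢ)`. -/
def diagOp (n : ℕ) (D : H →L[ℂ] H) :
    PiLp 2 (fun _ : Fin n => H) →ₗ[ℂ] PiLp 2 (fun _ : Fin n => H) where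
  toFun x := WithLp.toLp 2 (fun i => D (x i))
  map_add' x y := by ext i; simp
  map_smul' c x := by ext i; simp

variable [CompleteSpace H]

/-- The wandering subspace `W(X) = ⋂ᵢ ker Xᵢ*`. -/
def wandering (X : Fin n → H →L[ℂ] H) : Submodule ℂ H :=
  ⨅ i, LinearMap.ker (adjoint (X i)).toLinearMap

theorem isClosed_wandering (X : Fin n → H →L[ℂ] H) : IsClosed (wandering X : Set H) := by
  rw [wandering, Submodule.coe_iInf]
  exact isClosed_iInter fun i => (adjoint (X i)).isClosed_ker

instance (X : Fin n → H →L[ℂ] H) : CompleteSpace (wandering X) :=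
  (isClosed_wandering X).completeSpace_coe

/-- The linear map `σ_X(Y) = ∑ᵢ Xᵢ Y Xᵢ*` on `B(H)`. -/
def sigma (X : Fin n → H →L[ℂ] H) : (H →L[ℂ] H) →ₗ[ℂ] (H →L[ℂ] H) where
  toFun Y := ∑ i, X i * Y * adjoint (X i)
  map_add' Y Y' := by simp [mul_add, add_mul, Finset.sum_add_distrib]
  map_smul' c Y := by simp [Finset.smul_sum]

/-- The tuple `X` is pure if `σ_Xᵏ(I) → 0` in the strong operator topology. -/
def IsPureTuple (X : Fin n → H →L[ℂ] H) : Prop :=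
  ∀ h : H, Tendsto (fun k : ℕ => ((sigma X ^ k) 1) h) atTop (𝓝 0)

/-- `X` is regular at `z = 0`: for all `z` in some ball around `0`, the subspace `(X - Z) Hⁿ` is
closed and `H` is the algebraic direct sum of `(X - Z) Hⁿ` and `W(X)`. -/
def IsRegularAtZero (X : Fin n → H →L[ℂ] H) : Prop :=
  ∃ ε : ℝ, 0 < ε ∧ ∀ z : EuclideanSpace ℂ (Fin n), ‖z‖ < ε →
    IsClosed (LinearMap.range (rowOp X - rowOp (scalarTuple H z)).toLinearMap : Set H) ∧
    IsCompl (LinearMap.range (rowOp X - rowOp (scalarTuple H z)).toLinearMap) (wandering X)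

/-- `Δ_X = ∑_{j=0}^{m-1} (-1)^j (m choose j+1) σ_X^j(I)`. -/
def Delta (X : Fin n → H →L[ℂ] H) (m : ℕ) : H →L[ℂ] H :=
  ∑ j ∈ Finset.range m, ((-1 : ℂ) ^ j * (m.choose (j + 1) : ℂ)) • (sigma X ^ j) 1

/-- The identity `(X*X)⁻¹ = (⊕ Δ_X)|_{X*H}`: the operator `X*X` restricts to a bijection of `X*H`,
and the inverse of this bijection is the restriction of `⊕ Δ_X` to `X*H`. -/
def InverseGramIdentity (X : Fin n → H →L[ℂ] H) (m : ℕ) : Prop :=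
  ∃ e : LinearMap.range (adjoint (rowOp X)).toLinearMap ≃ₗ[ℂ]
      LinearMap.range (adjoint (rowOp X)).toLinearMap,
    (∀ y, (e y : PiLp 2 (fun _ : Fin n => H)) = adjoint (rowOp X) (rowOp X y)) ∧
    ∀ y, (e.symm y : PiLp 2 (fun _ : Fin n => H)) = diagOp n (Delta X m) y

end

end PureTuple

namespace PureTuple

/-! Put `S = T*`, which commutes with every `Xᵢ*` and so leaves `W(X)` invariant; the adjoint of the
compression is `S` restricted to `W(X)`, which gives (i) ⇒ (ii). For the converse let `a(h) = lim
‖Sᵏ h‖²`. The Gram identity makes `P = σ_X(Δ_X)` the orthogonal projection with kernel `W(X)`.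
Stability on `W(X)` gives `a(h) = a(P Sᵏ h) ≤ ⟪P Sᵏ h, Sᵏ h⟫`, and expanding `P` in powers of `σ_X`
and letting `k → ∞` yields `(1 - σ)ᵐ a ≤ 0`. Purity of `X` forces `σᵏ a → 0`, so the factors `1 - σ`
can be removed one at a time, leaving `a ≤ 0`, hence `a = 0`. -/

theorem one_sub_pow_eq_sum {R : Type*} [Ring R] [Algebra ℝ R] (a : R) (m : ℕ) :
    (1 - a) ^ m = ∑ j ∈ Finset.range (m + 1), ((-1 : ℝ) ^ j * (m.choose j : ℝ)) • a ^ j := by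
  rw [sub_eq_neg_add, (Commute.one_right _).add_pow]
  refine Finset.sum_congr rfl fun j _ => ?_
  rw [one_pow, mul_one, mul_smul, Nat.cast_smul_eq_nsmul, nsmul_eq_mul]
  rcases Nat.even_or_odd j with hj | hj <;>
    simp [hj.neg_one_pow, hj.neg_pow, Nat.cast_comm]

/-! ### Asymptotic form of a contraction -/

section AsymptoticForm

variable {H : Type*} [NormedAddCommGroup H] [InnerProductSpace ℂ H]

/-- The limit of the decreasing sequence `‖Sᵏ h‖²` for a contraction `S`. -/
noncomputable def asymptoticForm (S : H →L[ℂ] H) (h : H) : ℝ := ⨅ k : ℕ, ‖(S ^ k) h‖ ^ 2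

theorem norm_pow_apply_le {S : H →L[ℂ] H} (hS : ‖S‖ ≤ 1) (k : ℕ) (h : H) : ‖(S ^ k) h‖ ≤ ‖h‖ := by
  induction k with
  | zero => exact le_rfl
  | succ k ih =>
    rw [pow_succ', mul_apply_eq_comp]
    exact (by simpa using S.le_of_opNorm_le hS ((S ^ k) h) : ‖S ((S ^ k) h)‖ ≤ _).trans ih

theorem tendsto_asymptoticForm {S : H →L[ℂ] H} (hS : ‖S‖ ≤ 1) (h : H) :
    Tendsto (fun k : ℕ => ‖(S ^ k) h‖ ^ 2) atTop (𝓝 (asymptoticForm S h)) := by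
  refine tendsto_atTop_ciInf (antitone_nat_of_succ_le fun k => ?_)
    ⟨0, Set.forall_mem_range.2 fun k => by positivity⟩
  have hle := norm_pow_apply_le hS 1 ((S ^ k) h)
  rw [← mul_apply_eq_comp, ← pow_add, add_comm] at hle
  gcongr

theorem asymptoticForm_nonneg (S : H →L[ℂ] H) (h : H) : 0 ≤ asymptoticForm S h :=
  Real.iInf_nonneg fun _ => by positivity

theorem asymptoticForm_le {S : H →L[ℂ] H} (hS : ‖S‖ ≤ 1) (h : H) :
    asymptoticForm S h ≤ ‖h‖ ^ 2 :=
  le_of_tendsto' (tendsto_asymptoticForm hS h) fun k => by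
    have := norm_pow_apply_le hS k h
    gcongr

theorem asymptoticForm_pow_apply {S : H →L[ℂ] H} (hS : ‖S‖ ≤ 1) (k : ℕ) (h : H) :
    asymptoticForm S ((S ^ k) h) = asymptoticForm S h := by
  refine tendsto_nhds_unique (tendsto_asymptoticForm hS _) ?_
  simpa only [pow_add, mul_apply_eq_comp] using
    (tendsto_add_atTop_iff_nat k).2 (tendsto_asymptoticForm hS h)

theorem asymptoticForm_eq_of_tendsto_sub {S : H →L[ℂ] H} (hS : ‖S‖ ≤ 1) {g h : H}
    (hgh : Tendsto (fun k : ℕ => (S ^ k) (h - g)) atTop (𝓝 0)) :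
    asymptoticForm S h = asymptoticForm S g := by
  have hlim : ∀ x : H, Tendsto (fun k : ℕ => ‖(S ^ k) x‖) atTop (𝓝 √(asymptoticForm S x)) := by
    intro x
    simpa using (tendsto_asymptoticForm hS x).sqrt
  have hdiff : Tendsto (fun k : ℕ => ‖(S ^ k) h‖ - ‖(S ^ k) g‖) atTop (𝓝 0) := by
    refine squeeze_zero_norm (fun k => ?_) (tendsto_zero_iff_norm_tendsto_zero.1 hgh)
    simpa using abs_norm_sub_norm_le ((S ^ k) h) ((S ^ k) g)
  have hsqrt := sub_eq_zero.1 (tendsto_nhds_unique ((hlim h).sub (hlim g)) hdiff)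
  rwa [Real.sqrt_inj (asymptoticForm_nonneg S h) (asymptoticForm_nonneg S g)] at hsqrt

end AsymptoticForm

/-! ### The map `σ_X` on forms, the projection `σ_X(Δ_X)`, and compressions -/

section Tuple

variable {H : Type*} [NormedAddCommGroup H] [InnerProductSpace ℂ H] [CompleteSpace H] {n : ℕ}

/-- The action of a tuple on real functions: `f ↦ (h ↦ ∑ᵢ f (Xᵢ* h))`. On quadratic forms of
operators this is the map `σ_X`. -/
noncomputable def formSigma (X : Fin n → H →L[ℂ] H) : Module.End ℝ (H → ℝ) where
  toFun f h := ∑ i, f (adjoint (X i) h)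
  map_add' f g := by ext h; simp [Finset.sum_add_distrib]
  map_smul' c f := by ext h; simp [Finset.mul_sum]

theorem formSigma_apply (X : Fin n → H →L[ℂ] H) (f : H → ℝ) (h : H) :
    formSigma X f h = ∑ i, f (adjoint (X i) h) := rfl

theorem formSigma_pow_mono (X : Fin n → H →L[ℂ] H) (k : ℕ) : Monotone ⇑(formSigma X ^ k) := by
  induction k with
  | zero => exact fun f g hfg => hfg
  | succ k ih =>
    intro f g hfg
    rw [pow_succ, Module.End.mul_apply, Module.End.mul_apply]
    refine ih fun h => ?_
    rw [formSigma_apply, formSigma_apply]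
    exact Finset.sum_le_sum fun i _ => hfg _

theorem tendsto_formSigma_pow (X : Fin n → H →L[ℂ] H) (j : ℕ) {f : ℕ → H → ℝ} {g : H → ℝ}
    (hf : ∀ h, Tendsto (fun k => f k h) atTop (𝓝 (g h))) (h : H) :
    Tendsto (fun k => (formSigma X ^ j) (f k) h) atTop (𝓝 ((formSigma X ^ j) g h)) := by
  induction j generalizing h with
  | zero => exact hf h
  | succ j ih =>
    simp only [pow_succ', Module.End.mul_apply, formSigma_apply]
    exact tendsto_finsetSum _ fun i _ => ih _

theorem formSigma_pow_comp (X : Fin n → H →L[ℂ] H) (S : H →L[ℂ] H)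
    (hS : ∀ i h, S (adjoint (X i) h) = adjoint (X i) (S h)) (j : ℕ) (f : H → ℝ) (h : H) :
    (formSigma X ^ j) f (S h) = (formSigma X ^ j) (fun g => f (S g)) h := by
  induction j generalizing h with
  | zero => rfl
  | succ j ih => simp only [pow_succ', Module.End.mul_apply, formSigma_apply, ← hS, ih]

theorem re_inner_sigma_pow (X : Fin n → H →L[ℂ] H) (Y : H →L[ℂ] H) (j : ℕ) (h : H) :
    (inner ℂ ((sigma X ^ j) Y h) h).re =
      (formSigma X ^ j) (fun g => (inner ℂ (Y g) g).re) h := by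
  induction j generalizing h with
  | zero => rfl
  | succ j ih =>
    simp only [pow_succ', Module.End.mul_apply, formSigma_apply, ← ih]
    simp [sigma, ← adjoint_inner_right]

/-- A form whose `m`-th difference `(1 - σ)ᵐ E` is nonpositive and whose iterates `σᵏ E` tend to
zero is itself nonpositive. -/
theorem nonpos_of_one_sub_formSigma_pow (X : Fin n → H →L[ℂ] H) (m : ℕ) (E : H → ℝ)
    (hE : ∀ h, Tendsto (fun k => (formSigma X ^ k) E h) atTop (𝓝 0))
    (hle : ((1 - formSigma X) ^ m) E ≤ 0) : E ≤ 0 := by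
  induction m generalizing E with
  | zero => exact hle
  | succ m ih =>
    have hdiff : (1 - formSigma X) E ≤ 0 := by
      -- The decay hypothesis passes to `(1 - σ)E`, since `σᵏ(1 - σ)E = σᵏE - σᵏ⁺¹E`.
      refine ih _ (fun h => ?_) (by rwa [pow_succ, Module.End.mul_apply] at hle)
      have := (hE h).sub ((tendsto_add_atTop_iff_nat 1).2 (hE h))
      simpa [map_sub, pow_succ, Module.End.mul_apply] using this
    have hstep : E ≤ formSigma X E := by
      simpa [LinearMap.sub_apply, sub_nonpos] using hdiff
    have hmono : ∀ k, E ≤ (formSigma X ^ k) E := by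
      intro k
      induction k with
      | zero => exact le_rfl
      | succ k ihk =>
        rw [pow_succ, Module.End.mul_apply]
        exact ihk.trans (formSigma_pow_mono X k hstep)
    exact fun h => ge_of_tendsto' (hE h) fun k => hmono k h

theorem one_sub_formSigma_pow_apply (X : Fin n → H →L[ℂ] H) (m : ℕ) (f : H → ℝ) (h : H) :
    ((1 - formSigma X) ^ m) f h =
      f h - ∑ j ∈ Finset.range m,
        (-1 : ℝ) ^ j * (m.choose (j + 1) : ℝ) * (formSigma X ^ (j + 1)) f h := by
  rw [one_sub_pow_eq_sum, Finset.sum_range_succ']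
  simp [LinearMap.add_apply, LinearMap.sum_apply, pow_succ (-1 : ℝ), sub_eq_neg_add]

theorem re_inner_sigma_Delta (X : Fin n → H →L[ℂ] H) (m : ℕ) (h : H) :
    (inner ℂ (sigma X (Delta X m) h) h).re =
      ∑ j ∈ Finset.range m,
        (-1 : ℝ) ^ j * (m.choose (j + 1) : ℝ) * (formSigma X ^ (j + 1)) (fun g => ‖g‖ ^ 2) h := by
  have hone : (fun g : H => ‖g‖ ^ 2) = fun g => (inner ℂ ((1 : H →L[ℂ] H) g) g).re := by
    ext g
    simpa using (inner_self_eq_norm_sq (𝕜 := ℂ) g).symm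
  rw [Delta, map_sum, hone, sum_apply, sum_inner, Complex.re_sum]
  refine Finset.sum_congr rfl fun j _ => ?_
  rw [← re_inner_sigma_pow, map_smul, ← Module.End.mul_apply, ← pow_succ', smul_apply,
    inner_smul_left]
  have hreal : (starRingEnd ℂ) ((-1 : ℂ) ^ j * (m.choose (j + 1) : ℂ)) =
      (((-1 : ℝ) ^ j * (m.choose (j + 1) : ℝ) : ℝ) : ℂ) := by simp
  rw [hreal, Complex.re_ofReal_mul]

theorem adjoint_rowOp_apply (X : Fin n → H →L[ℂ] H) (h : H) :
    adjoint (rowOp X) h = WithLp.toLp 2 (fun i => adjoint (X i) h) := by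
  refine ext_inner_right ℂ fun y => ?_
  rw [adjoint_inner_left]
  simp [rowOp, PiLp.inner_apply, inner_sum, adjoint_inner_left]

theorem mem_wandering_iff (X : Fin n → H →L[ℂ] H) (h : H) :
    h ∈ wandering X ↔ ∀ i, adjoint (X i) h = 0 := by
  simp [wandering]

theorem rowOp_diagOp_adjoint (X : Fin n → H →L[ℂ] H) (D : H →L[ℂ] H) (h : H) :
    rowOp X (diagOp n D (adjoint (rowOp X) h)) = sigma X D h := by
  rw [adjoint_rowOp_apply]
  simp [rowOp, sigma, diagOp]

/-- The Gram identity gives `X*X(⊕Δ_X)X* = X*`, and `X(⊕Δ_X)X* = σ_X(Δ_X)`, so `X*` annihilates the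
difference. -/
theorem sub_sigma_Delta_mem_wandering (X : Fin n → H →L[ℂ] H) (m : ℕ)
    (hX : InverseGramIdentity X m) (h : H) : h - sigma X (Delta X m) h ∈ wandering X := by
  obtain ⟨e, he, hsymm⟩ := hX
  let y : LinearMap.range (adjoint (rowOp X)).toLinearMap := ⟨adjoint (rowOp X) h, h, rfl⟩
  have hinv : adjoint (rowOp X) (sigma X (Delta X m) h) = adjoint (rowOp X) h := by
    have hey := he (e.symm y)
    rw [e.apply_symm_apply, hsymm, rowOp_diagOp_adjoint] at hey
    exact hey.symm
  rw [mem_wandering_iff]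
  intro i
  rw [adjoint_rowOp_apply, adjoint_rowOp_apply] at hinv
  have := congrFun (WithLp.toLp_injective 2 hinv) i
  rw [map_sub, this, sub_self]

/-- `σ_X(Δ_X)h` is a sum of vectors from the ranges of the `Xᵢ`, hence orthogonal to `W(X)`, where
`h - σ_X(Δ_X)h` lies. -/
theorem norm_sigma_Delta_sq (X : Fin n → H →L[ℂ] H) (m : ℕ)
    (hX : InverseGramIdentity X m) (h : H) :
    ‖sigma X (Delta X m) h‖ ^ 2 = (inner ℂ (sigma X (Delta X m) h) h).re := by
  have hw := sub_sigma_Delta_mem_wandering X m hX h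
  rw [mem_wandering_iff] at hw
  have hort : inner ℂ (sigma X (Delta X m) h) (h - sigma X (Delta X m) h) = 0 := by
    generalize h - sigma X (Delta X m) h = w at hw
    simp [sigma, ← adjoint_inner_right, hw]
  have hself := inner_self_eq_norm_sq (𝕜 := ℂ) (sigma X (Delta X m) h)
  rw [inner_sub_right, sub_eq_zero] at hort
  rw [hort, ← hself]
  rfl

/-- A contraction that commutes with the adjoints `Xᵢ*` and is strongly stable on the wandering
subspace has `(1 - σ)ᵐ`-nonpositive asymptotic form. -/
theorem one_sub_formSigma_pow_asymptoticForm_nonpos (X : Fin n → H →L[ℂ] H) (m : ℕ)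
    (hX : InverseGramIdentity X m) {S : H →L[ℂ] H} (hS : ‖S‖ ≤ 1)
    (hSX : ∀ i h, S (adjoint (X i) h) = adjoint (X i) (S h))
    (hW : ∀ w ∈ wandering X, Tendsto (fun k : ℕ => (S ^ k) w) atTop (𝓝 0)) :
    ((1 - formSigma X) ^ m) (asymptoticForm S) ≤ 0 := by
  intro h
  have hcomm : ∀ (k : ℕ) i h, (S ^ k) (adjoint (X i) h) = adjoint (X i) ((S ^ k) h) := by
    intro k i
    induction k with
    | zero => exact fun h => rfl
    | succ k ih => exact fun h => by rw [pow_succ, mul_apply_eq_comp, mul_apply_eq_comp, hSX, ih]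
  have hle : ∀ k : ℕ, asymptoticForm S h ≤ ∑ j ∈ Finset.range m,
      (-1 : ℝ) ^ j * (m.choose (j + 1) : ℝ) *
        (formSigma X ^ (j + 1)) (fun g => ‖(S ^ k) g‖ ^ 2) h := by
    intro k
    -- Passing to `Sᵏ h` before projecting makes the bound involve `‖Sᵏ g‖²`, which converges to the
    -- asymptotic form. The alternating signs rule out termwise estimates, so the limit is taken in
    -- the whole finite sum.
    calc asymptoticForm S h = asymptoticForm S ((S ^ k) h) :=
          (asymptoticForm_pow_apply hS k h).symm
      _ = asymptoticForm S (sigma X (Delta X m) ((S ^ k) h)) :=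
          asymptoticForm_eq_of_tendsto_sub hS (hW _ (sub_sigma_Delta_mem_wandering X m hX _))
      _ ≤ ‖sigma X (Delta X m) ((S ^ k) h)‖ ^ 2 := asymptoticForm_le hS _
      _ = _ := by
          rw [norm_sigma_Delta_sq X m hX, re_inner_sigma_Delta]
          simp only [formSigma_pow_comp X (S ^ k) (hcomm k)]
  rw [one_sub_formSigma_pow_apply]
  rw [Pi.zero_apply, sub_nonpos]
  have hlim := tendsto_finsetSum (Finset.range m) fun j _ =>
    (tendsto_formSigma_pow X (j + 1) (tendsto_asymptoticForm hS) h).const_mul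
      ((-1 : ℝ) ^ j * (m.choose (j + 1) : ℝ))
  exact ge_of_tendsto' hlim hle

theorem tendsto_formSigma_pow_asymptoticForm (X : Fin n → H →L[ℂ] H) (hpure : IsPureTuple X)
    {S : H →L[ℂ] H} (hS : ‖S‖ ≤ 1) (h : H) :
    Tendsto (fun k => (formSigma X ^ k) (asymptoticForm S) h) atTop (𝓝 0) := by
  have hnorm : Tendsto (fun k => (formSigma X ^ k) (fun g => ‖g‖ ^ 2) h) atTop (𝓝 0) := by
    have hinner : Tendsto (fun k => (inner ℂ ((sigma X ^ k) 1 h) h).re) atTop (𝓝 0) := by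
      have := Complex.continuous_re.tendsto _ |>.comp
        ((hpure h).inner (𝕜 := ℂ) (tendsto_const_nhds (x := h)))
      simpa [Function.comp_def] using this
    have hone : (fun g : H => ‖g‖ ^ 2) = fun g => (inner ℂ ((1 : H →L[ℂ] H) g) g).re := by
      ext g
      simpa using (inner_self_eq_norm_sq (𝕜 := ℂ) g).symm
    simpa only [re_inner_sigma_pow, ← hone] using hinner
  -- Monotonicity of `σᵏ` traps the iterates between `0` and `σᵏ(‖·‖²)`, the quadratic form of
  -- `σ_Xᵏ(I)`.
  refine squeeze_zero (fun k => ?_) (fun k => ?_) hnorm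
  · have := formSigma_pow_mono X k (show (0 : H → ℝ) ≤ asymptoticForm S from
      asymptoticForm_nonneg S) h
    simpa using this
  · exact formSigma_pow_mono X k (asymptoticForm_le hS) h

/-- A contraction commuting with the adjoints `Xᵢ*` that is strongly stable on the wandering
subspace is strongly stable. -/
theorem tendsto_pow_of_tendsto_on_wandering (X : Fin n → H →L[ℂ] H) (hpure : IsPureTuple X)
    (m : ℕ) (hX : InverseGramIdentity X m) {S : H →L[ℂ] H} (hS : ‖S‖ ≤ 1)
    (hSX : ∀ i h, S (adjoint (X i) h) = adjoint (X i) (S h))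
    (hW : ∀ w ∈ wandering X, Tendsto (fun k : ℕ => (S ^ k) w) atTop (𝓝 0)) (h : H) :
    Tendsto (fun k : ℕ => (S ^ k) h) atTop (𝓝 0) := by
  have hle := nonpos_of_one_sub_formSigma_pow X m (asymptoticForm S)
    (tendsto_formSigma_pow_asymptoticForm X hpure hS)
    (one_sub_formSigma_pow_asymptoticForm_nonpos X m hX hS hSX hW) h
  have hlim := (tendsto_asymptoticForm hS h).sqrt
  rw [le_antisymm hle (asymptoticForm_nonneg S h)] at hlim
  rw [tendsto_zero_iff_norm_tendsto_zero]
  simpa using hlim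

/-- Invariance of `K` under `T*` makes the projection in the adjoint of the compression redundant,
so powers agree too. -/
theorem adjoint_compression_pow_apply (K : Submodule ℂ H) [CompleteSpace K] (T : H →L[ℂ] H)
    (hK : ∀ w ∈ K, adjoint T w ∈ K) (k : ℕ) (w : K) :
    (((adjoint (compression K T)) ^ k) w : H) = ((adjoint T) ^ k) w := by
  have hone : ∀ w : K, (adjoint (compression K T) w : H) = adjoint T w := by
    intro w
    have : adjoint (compression K T) w = ⟨adjoint T w, hK w w.2⟩ := by
      refine ext_inner_right ℂ fun v => ?_
      simp [adjoint_inner_left, compression]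
    rw [this]
  induction k with
  | zero => rfl
  | succ k ih => rw [pow_succ', pow_succ', mul_apply_eq_comp, mul_apply_eq_comp, hone, ih]

omit [CompleteSpace H] in
theorem norm_compression_le (K : Submodule ℂ H) [CompleteSpace K] (T : H →L[ℂ] H) :
    ‖compression K T‖ ≤ ‖T‖ := by
  refine opNorm_le_bound _ (norm_nonneg _) fun w => ?_
  exact (K.norm_orthogonalProjectionOnto_apply_le _).trans (T.le_opNorm w)

end Tuple

end PureTuple

theorem mainTheorem5 {H : Type*} [NormedAddCommGroup H] [InnerProductSpace ℂ H] [CompleteSpace H]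
    (n : ℕ) (X : Fin n → H →L[ℂ] H)
    (hcomm : ∀ i j, X i * X j = X j * X i)
    (hpure : PureTuple.IsPureTuple X)
    (hreg : PureTuple.IsRegularAtZero X)
    (m : ℕ) (hm : 1 ≤ m)
    (hX : PureTuple.InverseGramIdentity X m)
    (T : H →L[ℂ] H) (hT : ‖T‖ ≤ 1)
    (hTX : ∀ i, T * X i = X i * T) :
    PureTuple.IsPureContraction T ↔
      PureTuple.IsPureContraction
        (PureTuple.compression (PureTuple.wandering X) T) := by
  have hSX : ∀ i h, adjoint T (adjoint (X i) h) = adjoint (X i) (adjoint T h) := by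
    intro i h
    have := congrArg adjoint (hTX i)
    simp only [mul_def, adjoint_comp] at this
    exact (DFunLike.congr_fun this h).symm
  have hinv : ∀ w ∈ PureTuple.wandering X, adjoint T w ∈ PureTuple.wandering X := by
    intro w hw
    rw [PureTuple.mem_wandering_iff] at hw ⊢
    intro i
    rw [← hSX, hw, map_zero]
  constructor
  · rintro ⟨-, hlim⟩
    refine ⟨(PureTuple.norm_compression_le _ T).trans hT, fun w => ?_⟩
    rw [Topology.IsEmbedding.subtypeVal.tendsto_nhds_iff]
    simpa only [Function.comp_def, ZeroMemClass.coe_zero, PureTuple.adjoint_compression_pow_apply _ T hinv] using hlim w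
  · rintro ⟨-, hlim⟩
    refine ⟨hT, PureTuple.tendsto_pow_of_tendsto_on_wandering X hpure m hX
      (by rwa [LinearIsometryEquiv.norm_map]) hSX fun w hw => ?_⟩
    have := (continuous_subtype_val.tendsto _).comp (hlim ⟨w, hw⟩)
    simpa only [Function.comp_def, ZeroMemClass.coe_zero, PureTuple.adjoint_compression_pow_apply _ T hinv] using this
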